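/- Let $K$ be a simplicial complex with exactly $m\ge 1$ vertices and let $\mathbb F$ be a field. Let $\widetilde\beta_i(K;\mathbb F)=\dim_{\mathbb F}\widetilde H_i(K;\mathbb F)$ ($i\ge -1$) be its reduced Betti numbers, where $\widetilde H_i$ is reduced simplicial homology, and let $\widetilde{tb}(K;\mathbb F)=\sum_{i}\widetilde\beta_i(K;\mathbb F)$ be its reduced total Betti number. Then $$\widetilde{tb}(K;\mathbb F)\le\binom{m-1}{\left[\frac{m-1}{2}\right]},$$ where $[x]$ denotes the integer part of $x$. Moreover, equality holds if and only if $K$ is isomorphic to the $k$-skeleton of an $(m-1)$-dimensional simplex, where $k=\frac{m-3}{2}$ if $m$ is odd, and $k=\frac m2-1$ or $k=\frac m2-2$ if $m$ is even. (The $k$-skeleton consists of all simplices of dimension at most $k$; for $k=-1$ it has no vertices.) -/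

import Mathlib

namespace PreAbstractSimplicialComplex

section Combinatorics

variable {V W : Type*}

/-- The vertex set of a simplicial complex. -/
def vertices (K : PreAbstractSimplicialComplex V) : Set V :=
  {v | {v} ∈ K.faces}

/-- The `k`-skeleton of a simplicial complex: its simplices of dimension at most `k`, where
a simplex of dimension `d` has `d + 1` vertices. For `k ≤ -1` it has no (nonempty) simplex. -/
def skeleton (K : PreAbstractSimplicialComplex V) (k : ℤ) : PreAbstractSimplicialComplex V where
  faces := {s | s ∈ K.faces ∧ (s.card : ℤ) ≤ k + 1}
  isRelLowerSet_faces := by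
    intro s hs
    refine ⟨(K.isRelLowerSet_faces hs.1).1, fun t hts ht => ⟨?_, ?_⟩⟩
    · exact (K.isRelLowerSet_faces hs.1).2 hts ht
    · have h1 : t.card ≤ s.card := Finset.card_le_card hts
      have h2 := hs.2
      omega

/-- Two simplicial complexes are isomorphic if some bijection between their vertex sets
identifies their sets of simplices. -/
def Isomorphic (K : PreAbstractSimplicialComplex V) (L : PreAbstractSimplicialComplex W) : Prop :=
  ∃ e : K.vertices ≃ L.vertices, ∀ s : Finset K.vertices,
    s.map (Function.Embedding.subtype (· ∈ K.vertices)) ∈ K.faces ↔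
      (s.map e.toEmbedding).map (Function.Embedding.subtype (· ∈ L.vertices)) ∈ L.faces

end Combinatorics

/-- The quotient `Z / (Z ∩ B)` of two subspaces of a vector space, which is `Z / B` if `B ≤ Z`. -/
abbrev Subquotient {F M : Type*} [Field F] [AddCommGroup M] [Module F M] (Z B : Submodule F M) :
    Type _ :=
  Z ⧸ B.submoduleOf Z

noncomputable section Homology

variable {V : Type*} [LinearOrder V] (F : Type*) [Field F]

/-- The simplicial boundary map. A finite set `σ = {v₀ < v₁ < ⋯ < vₙ}` stands for the oriented
simplex `[v₀, …, vₙ]`, which is sent to `∑ⱼ (-1)ʲ [v₀, …, v̂ⱼ, …, vₙ]`; here `j` is the number of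
vertices of `σ` smaller than `vⱼ`. Vertices are sent to the empty simplex (the augmentation), and
the empty simplex is sent to `0`. -/
def boundaryMap : (Finset V →₀ F) →ₗ[F] (Finset V →₀ F) :=
  Finsupp.linearCombination F fun σ : Finset V =>
    ∑ v ∈ σ, Finsupp.single (σ.erase v) ((-1 : F) ^ (σ.filter (· < v)).card)

variable (K : PreAbstractSimplicialComplex V) (i : ℤ)

/-- The simplicial chains of dimension `i` of the augmented chain complex of `K`: linear
combinations of the simplices of `K` with `i + 1` vertices, where the empty simplex, of dimension
`-1`, is counted as a simplex of every complex. -/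
def reducedChains : Submodule F (Finset V →₀ F) :=
  Finsupp.supported F F {σ : Finset V | (σ ∈ K.faces ∨ σ = ∅) ∧ (σ.card : ℤ) = i + 1}

/-- The cycles of dimension `i`. -/
def reducedCycles : Submodule F (Finset V →₀ F) :=
  reducedChains F K i ⊓ LinearMap.ker (boundaryMap F)

/-- The boundaries of dimension `i`. -/
def reducedBoundaries : Submodule F (Finset V →₀ F) :=
  (reducedChains F K (i + 1)).map (boundaryMap F)

/-- The reduced homology group of `K` in dimension `i`, with coefficients in `F`: cycles modulo
boundaries. -/
abbrev ReducedHomology : Type _ :=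
  Subquotient (reducedCycles F K i) (reducedBoundaries F K i)

/-- The reduced Betti number of `K` in dimension `i` over `F`. -/
def reducedBetti : ℕ :=
  Module.finrank F (ReducedHomology F K i)

/-- The reduced total Betti number: the sum of all reduced Betti numbers. A simplicial complex on
a finite set `V` only has simplices of dimensions `-1, 0, …, |V| - 1`. -/
def reducedTotalBetti [Fintype V] : ℕ :=
  ∑ i ∈ Finset.Icc (-1 : ℤ) ((Fintype.card V : ℤ) - 1), reducedBetti F K i

end Homology

end PreAbstractSimplicialComplex

/-! Fix a vertex `v`. A cycle is determined by its coefficients at the sets avoiding `v`. Gaussian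
elimination on these coefficients, in colex order, gives the cycles and the boundaries their leading
faces, and each Betti number is at most the number of critical faces of that dimension: those
leading a cycle but no boundary (`DeterminedAwayFrom.finrank_subquotient_le`). If `S` leads a cycle
`z` and `a ∈ S`, then `S.erase a` leads the boundary of the part of `z` on the simplices containing
`a` (`erase_mem_leadingFaces_reducedBoundaries`). Hence every proper subset of `S` leads a boundary,
the critical faces form an antichain on the `m - 1` vertices other than `v`, and Sperner's theorem
gives the bound.

In the equality case the antichain is a full middle layer, of size `r` say
(`eq_powersetCard_of_isAntichain_of_card_eq`). Since all its members lead cycles, `K` carries every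
cycle of the full simplex in dimension `r - 1`; since none leads a boundary, `K` has no face with `r
+ 1` vertices. Conversely, a skeleton has no boundaries in its top dimension, and the boundaries of
the cones from `v` are enough independent cycles there. -/

namespace Finset

/-! ### Equality in Sperner's theorem. -/

variable {α : Type*} [Fintype α]

theorem eq_of_choose_eq_choose_middle {n r : ℕ} (h : n.choose r = n.choose (n / 2)) :
    r = n / 2 ∨ r = n - n / 2 := by
  have hlt : ∀ s, s < n / 2 → n.choose s < n.choose (n / 2) := by
    intro s hs
    refine lt_of_lt_of_le ?_ (Nat.choose_le_middle (s + 1) n)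
    have h1 := Nat.choose_succ_right_eq n s
    have h2 : 0 < n.choose s := Nat.choose_pos (by omega)
    by_contra! h3
    have h4 : n.choose s * (s + 1) < n.choose s * (n - s) :=
      Nat.mul_lt_mul_of_pos_left (by omega) h2
    have h5 := Nat.mul_le_mul_right (s + 1) h3
    omega
  have hrn : r ≤ n := by
    by_contra! hr
    rw [Nat.choose_eq_zero_of_lt hr] at h
    have := Nat.choose_pos (Nat.div_le_self n 2)
    omega
  rcases lt_trichotomy r (n / 2) with hr | hr | hr
  · exact absurd h (hlt r hr).ne
  · exact Or.inl hr
  · right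
    by_contra hne
    have h1 := hlt (n - r) (by omega)
    rw [Nat.choose_symm hrn] at h1
    omega

/-- In the LYM inequality each term is at least the inverse of the middle binomial coefficient. Here
those lower bounds already sum to 1, so every term attains its bound. -/
theorem choose_card_eq_of_isAntichain_of_card_eq {𝒜 : Finset (Finset α)}
    (h𝒜 : IsAntichain (· ⊆ ·) (𝒜 : Set (Finset α)))
    (hcard : #𝒜 = (Fintype.card α).choose (Fintype.card α / 2)) {s : Finset α} (hs : s ∈ 𝒜) :
    (Fintype.card α).choose #s = (Fintype.card α).choose (Fintype.card α / 2) := by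
  have hpos : 0 < ((Fintype.card α).choose (Fintype.card α / 2) : ℚ) :=
    Nat.cast_pos.2 <| Nat.choose_pos (Nat.div_le_self _ _)
  have hle : ∀ t ∈ 𝒜, ((Fintype.card α).choose (Fintype.card α / 2) : ℚ)⁻¹ ≤
      ((Fintype.card α).choose #t : ℚ)⁻¹ := by
    intro t _
    gcongr
    · exact mod_cast Nat.choose_pos t.card_le_univ
    · exact Nat.choose_le_middle _ _
  have hsum : ∑ t ∈ 𝒜, ((Fintype.card α).choose (Fintype.card α / 2) : ℚ)⁻¹ = 1 := by
    rw [sum_const, hcard, nsmul_eq_mul, mul_inv_cancel₀ hpos.ne']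
  have heq := (sum_eq_sum_iff_of_le hle).1 (le_antisymm (sum_le_sum hle) <| by
    rw [hsum]; exact lubell_yamamoto_meshalkin_inequality_sum_inv_choose h𝒜) s hs
  exact_mod_cast (inv_injective heq).symm

/-- A family of finite sets closed under exchanging one element contains, with a set, every set
of the same size. -/
theorem mem_of_exchange {α : Type*} [DecidableEq α] {ℬ : Finset (Finset α)}
    (h : ∀ s ∈ ℬ, ∀ a ∈ s, ∀ b ∉ s, insert b (s.erase a) ∈ ℬ) {s t : Finset α} (hs : s ∈ ℬ)
    (hst : #t = #s) : t ∈ ℬ := by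
  induction hn : #(t \ s) generalizing s with
  | zero =>
    rw [card_eq_zero, sdiff_eq_empty_iff_subset] at hn
    rwa [eq_of_subset_of_card_le hn hst.ge]
  | succ n ih =>
    obtain ⟨b, hb⟩ : (t \ s).Nonempty := card_pos.1 (by omega)
    obtain ⟨a, ha⟩ : (s \ t).Nonempty := by
      rw [← card_pos, card_sdiff_comm hst.symm]; omega
    rw [mem_sdiff] at ha hb
    refine ih (h s hs a ha.1 b hb.2) ?_ ?_
    · rw [card_insert_of_notMem (by simp [hb.2]), card_erase_of_mem ha.1, hst]
      have := card_pos.2 ⟨a, ha.1⟩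
      omega
    · have : t \ insert b (s.erase a) = (t \ s).erase b := by
        ext x
        simp only [mem_sdiff, mem_insert, mem_erase]
        by_cases hx : x = a
        · subst hx; simp [ha.2]
        · tauto
      rw [this, card_erase_of_mem (by simp [hb]), hn]
      rfl

/-- Double counting of inclusions: each member of `ℬ` has `k + 1` subsets of size `k`, and each set
in the shadow has `n - k = k + 1` one-point extensions. Some exchange leads out of `ℬ`, so one set
of the shadow has an extension outside `ℬ` and the count is strict. -/
theorem card_lt_card_shadow [DecidableEq α] {ℬ : Finset (Finset α)} {k : ℕ}
    (hn : Fintype.card α = 2 * k + 1) (hℬ : (ℬ : Set (Finset α)).Sized (k + 1))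
    {s : Finset α} (hs : s ∈ ℬ) {t : Finset α} (ht : #t = k + 1) (htℬ : t ∉ ℬ) :
    #ℬ < #(shadow ℬ) := by
  classical
  obtain ⟨s, hs, a, ha, b, hb, hsb⟩ :
      ∃ s ∈ ℬ, ∃ a ∈ s, ∃ b ∉ s, insert b (s.erase a) ∉ ℬ := by
    by_contra! h
    exact htℬ (mem_of_exchange h hs (by rw [ht, hℬ hs]))
  have hsized : (shadow ℬ : Set (Finset α)).Sized k := hℬ.shadow
  have habove : ∀ u ∈ shadow ℬ,
      bipartiteBelow (fun s t => t ⊆ s) ℬ u ⊆ (uᶜ).image fun x => insert x u := by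
    intro u hu v hv
    rw [mem_bipartiteBelow] at hv
    obtain ⟨x, hx, rfl⟩ := exists_eq_insert_iff.2 ⟨hv.2, by rw [hsized hu, hℬ hv.1]⟩
    exact mem_image_of_mem _ (mem_compl.2 hx)
  have hcard : ∀ u ∈ shadow ℬ, #((uᶜ).image fun x => insert x u) = k + 1 := by
    intro u hu
    rw [card_image_of_injOn, card_compl, hsized hu, hn]
    · omega
    · simpa using insert_inj_on' u
  have hbelow : ∀ u ∈ ℬ, k + 1 ≤ #(bipartiteAbove (fun s t => t ⊆ s) (shadow ℬ) u) := by
    intro u hu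
    rw [← hℬ hu, ← card_image_of_injOn u.erase_injOn]
    refine card_le_card (image_subset_iff.2 fun x hx => ?_)
    exact (mem_bipartiteAbove _).2 ⟨erase_mem_shadow hu hx, erase_subset _ _⟩
  have key : #ℬ * (k + 1) < #(shadow ℬ) * (k + 1) :=
    calc #ℬ * (k + 1) = ∑ u ∈ ℬ, (k + 1) := by rw [sum_const, smul_eq_mul]
      _ ≤ ∑ u ∈ ℬ, #(bipartiteAbove (fun s t => t ⊆ s) (shadow ℬ) u) := sum_le_sum hbelow
      _ = ∑ u ∈ shadow ℬ, #(bipartiteBelow (fun s t => t ⊆ s) ℬ u) :=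
        sum_card_bipartiteAbove_eq_sum_card_bipartiteBelow _
      _ < ∑ u ∈ shadow ℬ, (k + 1) := by
        refine sum_lt_sum (fun u hu => (card_le_card (habove u hu)).trans (hcard u hu).le)
          ⟨s.erase a, erase_mem_shadow hs ha, ?_⟩
        rw [← hcard _ (erase_mem_shadow hs ha)]
        refine card_lt_card ((ssubset_iff_of_subset (habove _ (erase_mem_shadow hs ha))).2
          ⟨insert b (s.erase a), mem_image_of_mem _ (by simp [hb]), fun h => ?_⟩)
        exact hsb ((mem_bipartiteBelow _).1 h).1
      _ = #(shadow ℬ) * (k + 1) := by rw [sum_const, smul_eq_mul]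
  exact lt_of_mul_lt_mul_right key (Nat.zero_le _)

/-- The equality case of **Sperner's theorem**: the largest antichains are the middle layers. -/
theorem eq_powersetCard_of_isAntichain_of_card_eq {𝒜 : Finset (Finset α)}
    (h𝒜 : IsAntichain (· ⊆ ·) (𝒜 : Set (Finset α)))
    (hcard : #𝒜 = (Fintype.card α).choose (Fintype.card α / 2)) :
    ∃ r, (r = Fintype.card α / 2 ∨ r = Fintype.card α - Fintype.card α / 2) ∧
      𝒜 = powersetCard r univ := by
  classical
  set n := Fintype.card α with hn
  have hsize : ∀ s ∈ 𝒜, #s = n / 2 ∨ #s = n - n / 2 := fun s hs =>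
    eq_of_choose_eq_choose_middle (choose_card_eq_of_isAntichain_of_card_eq h𝒜 hcard hs)
  by_cases hall : ∀ s ∈ 𝒜, #s = n / 2
  · exact ⟨n / 2, Or.inl rfl, eq_of_subset_of_card_le
      (fun s hs => mem_powersetCard_univ.2 (hall s hs))
      (by rw [card_powersetCard, card_univ, hcard])⟩
  push Not at hall
  obtain ⟨s, hs, hs'⟩ := hall
  have hsn := (hsize s hs).resolve_left hs'
  refine ⟨n - n / 2, Or.inr rfl, (eq_of_subset_of_card_le (fun t ht => ?_) ?_).symm⟩
  swap
  · rw [card_powersetCard, card_univ, hcard, ← hn, Nat.choose_symm (Nat.div_le_self n 2)]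
  set k := n / 2 with hk
  have hodd : n = 2 * k + 1 := by
    have := hsize s hs
    omega
  have hnk : n - k = k + 1 := by omega
  rw [mem_powersetCard_univ, hnk] at ht
  have hℬ : ((𝒜.filter (¬ #· = k) : Finset (Finset α)) : Set (Finset α)).Sized (k + 1) := by
    intro u hu
    rw [mem_coe, mem_filter] at hu
    rw [(hsize u hu.1).resolve_left hu.2, hnk]
  by_contra htA
  -- If the upper layer were only partly used, replacing that part of `𝒜` by its shadow would give a
  -- strictly larger family inside layer `k`.
  have hlt := card_lt_card_shadow (hn.symm.trans hodd) hℬ (mem_filter.2 ⟨hs, hs'⟩) ht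
    fun h => htA (mem_filter.1 h).1
  have hdisj : Disjoint (𝒜.filter (#· = k)) (shadow (𝒜.filter (¬ #· = k))) := by
    refine disjoint_left.2 fun u hu hu' => ?_
    obtain ⟨w, hw, a, ha, rfl⟩ := mem_shadow_iff.1 hu'
    refine h𝒜 (mem_filter.1 hu).1 (mem_filter.1 hw).1 ?_ (erase_subset _ _)
    exact (erase_ssubset ha).ne
  have hle : #(𝒜.filter (#· = k) ∪ shadow (𝒜.filter (¬ #· = k))) ≤ n.choose k := by
    rw [hn, ← card_univ, ← card_powersetCard]
    refine card_le_card (union_subset (fun u hu => ?_) fun u hu => ?_)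
    · exact mem_powersetCard_univ.2 (mem_filter.1 hu).2
    · exact mem_powersetCard_univ.2 (hℬ.shadow hu)
  have hadd := card_filter_add_card_filter_not (s := 𝒜) (#· = k)
  rw [card_union_of_disjoint hdisj] at hle
  omega

end Finset

namespace PreAbstractSimplicialComplex

open Finset

/-! ### Elimination in colex order, and the boundary map in coordinates. -/

section LeadingFaces

variable {V : Type*} [LinearOrder V] {F : Type*} [Field F]

/-- `S` is the colexicographically largest set in the support of the chain `z` among those which
avoid the vertex `v`. -/
def IsLeadingFace (v : V) (z : Finset V →₀ F) (S : Finset V) : Prop :=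
  v ∉ S ∧ z S ≠ 0 ∧ ∀ T, v ∉ T → toColex S < toColex T → z T = 0

/-- The leading faces of the chains in a subspace. -/
def leadingFaces (v : V) (Z : Submodule F (Finset V →₀ F)) : Set (Finset V) :=
  {S | ∃ z ∈ Z, IsLeadingFace v z S}

/-- A subspace of chains is determined away from `v` if a chain in it vanishes as soon as its
coefficients at the sets avoiding `v` do. -/
def DeterminedAwayFrom (v : V) (Z : Submodule F (Finset V →₀ F)) : Prop :=
  ∀ z ∈ Z, (∀ T, v ∉ T → z T = 0) → z = 0

theorem leadingFaces_mono (v : V) {Z N : Submodule F (Finset V →₀ F)} (h : N ≤ Z) :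
    leadingFaces v N ⊆ leadingFaces v Z :=
  fun _ ⟨z, hz, hS⟩ => ⟨z, h hz, hS⟩

theorem DeterminedAwayFrom.exists_isLeadingFace {v : V} {Z : Submodule F (Finset V →₀ F)}
    (hZ : DeterminedAwayFrom v Z) {z : Finset V →₀ F} (hz : z ∈ Z) (h0 : z ≠ 0) :
    ∃ S, IsLeadingFace v z S := by
  have hne : (z.support.filter (v ∉ ·)).Nonempty := by
    by_contra h
    rw [not_nonempty_iff_eq_empty, filter_eq_empty_iff] at h
    refine h0 (hZ z hz fun T hT => ?_)
    by_contra hzT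
    exact h (Finsupp.mem_support_iff.2 hzT) hT
  obtain ⟨S, hS, hmax⟩ := exists_max_image _ toColex hne
  rw [mem_filter, Finsupp.mem_support_iff] at hS
  refine ⟨S, hS.2, hS.1, fun T hT hlt => ?_⟩
  by_contra hzT
  exact absurd (hmax T (mem_filter.2 ⟨Finsupp.mem_support_iff.2 hzT, hT⟩)) (not_le.2 hlt)

/-- Subtracting a multiple of an element of `N` with the same leading face leaves zero or a chain
with a colex-smaller leading face, so reduction terminates. -/
theorem DeterminedAwayFrom.le_of_leadingFaces_subset [Finite V] {v : V}
    {Z N : Submodule F (Finset V →₀ F)} (hZ : DeterminedAwayFrom v Z) (hN : N ≤ Z)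
    (h : leadingFaces v Z ⊆ leadingFaces v N) : Z ≤ N := by
  have key : ∀ S : Colex (Finset V), ∀ z ∈ Z, IsLeadingFace v z (ofColex S) → z ∈ N := by
    have : Finite (Colex (Finset V)) := inferInstanceAs (Finite (Finset V))
    intro S
    induction S using WellFoundedLT.induction with
    | ind S ih =>
      intro z hz hS
      obtain ⟨g, hg, hgS⟩ := h ⟨z, hz, hS⟩
      set c := z (ofColex S) / g (ofColex S) with hc
      have hz' : z - c • g ∈ N := by
        by_cases h0 : z - c • g = 0
        · rw [h0]; exact N.zero_mem
        have hzg : z - c • g ∈ Z := Z.sub_mem hz (Z.smul_mem _ (hN hg))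
        obtain ⟨T, hT⟩ := hZ.exists_isLeadingFace hzg h0
        refine ih (toColex T) ?_ _ hzg hT
        by_contra hle
        rcases (not_lt.1 hle).eq_or_lt with heq | hlt
        · refine hT.2.1 ?_
          have hST : ofColex S = T := congrArg ofColex heq
          rw [← hST, Finsupp.sub_apply, Finsupp.smul_apply, smul_eq_mul, hc,
            div_mul_cancel₀ _ hgS.2.1, sub_self]
        · refine hT.2.1 ?_
          rw [Finsupp.sub_apply, Finsupp.smul_apply, hS.2.2 T hT.1 hlt, hgS.2.2 T hT.1 hlt,
            smul_zero, sub_zero]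
      have := N.add_mem hz' (N.smul_mem c hg)
      rwa [sub_add_cancel] at this
  intro z hz
  by_cases h0 : z = 0
  · rw [h0]; exact N.zero_mem
  · obtain ⟨S, hS⟩ := hZ.exists_isLeadingFace hz h0
    exact key (toColex S) z hz hS

theorem finrank_subquotient_le_of_le_sup {M : Type*} [AddCommGroup M] [Module F M]
    {Z B W : Submodule F M} [Module.Finite F W] (hW : W ≤ Z) (h : Z ≤ B ⊔ W) :
    Module.finrank F (Subquotient Z B) ≤ Module.finrank F W := by
  let g : W →ₗ[F] Subquotient Z B := (B.submoduleOf Z).mkQ.comp (Submodule.inclusion hW)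
  refine LinearMap.finrank_le_finrank_of_surjective (f := g) fun q => ?_
  obtain ⟨⟨z, hz⟩, rfl⟩ := (B.submoduleOf Z).mkQ_surjective q
  obtain ⟨b, hb, w, hw, rfl⟩ := Submodule.mem_sup.1 (h hz)
  refine ⟨⟨w, hw⟩, ?_⟩
  change (B.submoduleOf Z).mkQ _ = _
  rw [← sub_eq_zero, ← map_sub, Submodule.mkQ_apply, Submodule.Quotient.mk_eq_zero]
  change w - (b + w) ∈ B
  simpa using hb

variable (F) in
theorem finrank_subquotient_bot {M : Type*} [AddCommGroup M] [Module F M]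
    (Z : Submodule F M) :
    Module.finrank F (Subquotient Z (⊥ : Submodule F M)) = Module.finrank F Z := by
  have h : (⊥ : Submodule F M).submoduleOf Z = ⊥ :=
    eq_bot_iff.2 fun x hx => Subtype.ext hx
  exact ((Submodule.quotEquivOfEqBot ((⊥ : Submodule F M).submoduleOf Z) h).finrank_eq :)

/-- One chain of `Z` for each set in `A` suffices: together with `B`, these chains realize all
leading faces of `Z`, so they span `Z` modulo `B`. -/
theorem DeterminedAwayFrom.finrank_subquotient_le [Finite V] {v : V}
    {Z B : Submodule F (Finset V →₀ F)} (hZ : DeterminedAwayFrom v Z) (hB : B ≤ Z)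
    {A : Finset (Finset V)} (hA : leadingFaces v Z \ leadingFaces v B ⊆ A) :
    Module.finrank F (Subquotient Z B) ≤ #A := by
  classical
  have hex : ∀ S, ∃ z ∈ Z, S ∈ leadingFaces v Z → IsLeadingFace v z S := by
    intro S
    by_cases hS : S ∈ leadingFaces v Z
    · obtain ⟨z, hz, h⟩ := hS
      exact ⟨z, hz, fun _ => h⟩
    -- Sets that are not leading faces get the harmless value 0.
    · exact ⟨0, Z.zero_mem, fun h => absurd h hS⟩
  choose f hfZ hf using hex
  set W := Submodule.span F ((A.image f : Finset (Finset V →₀ F)) : Set (Finset V →₀ F)) with hW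
  have hWZ : W ≤ Z := by
    rw [hW, Submodule.span_le]
    intro z hz
    obtain ⟨S, -, rfl⟩ := mem_image.1 (mem_coe.1 hz)
    exact hfZ S
  have hle : Z ≤ B ⊔ W := by
    refine hZ.le_of_leadingFaces_subset (sup_le hB hWZ) fun S hS => ?_
    by_cases hSB : S ∈ leadingFaces v B
    · exact leadingFaces_mono v le_sup_left hSB
    · refine ⟨f S, le_sup_right (a := B) (Submodule.subset_span ?_), hf S hS⟩
      exact mem_coe.2 (mem_image_of_mem f (hA ⟨hS, hSB⟩))
  have : Module.Finite F W := Module.Finite.span_finset F _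
  calc Module.finrank F (Subquotient Z B) ≤ Module.finrank F W :=
        finrank_subquotient_le_of_le_sup hWZ hle
    _ ≤ #(A.image f) := finrank_span_finset_le_card _
    _ ≤ #A := card_image_le

/-- The transposed form of the boundary: a coefficient is a signed sum over the one-point extensions
of `ρ`. -/
theorem boundaryMap_apply [Fintype V] (z : Finset V →₀ F) (ρ : Finset V) :
    boundaryMap F z ρ = ∑ u ∈ ρᶜ, (-1) ^ #(ρ.filter (· < u)) * z (insert u ρ) := by
  induction z using Finsupp.induction_linear with
  | zero => simp
  | add f g hf hg => simp [hf, hg, mul_add, sum_add_distrib]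
  | single σ c =>
    rw [boundaryMap, Finsupp.linearCombination_single, Finsupp.smul_apply, Finsupp.finsetSum_apply,
      smul_sum]
    refine sum_congr_of_eq_on_inter ?_ ?_ ?_
    · intro u hu hu'
      rw [Finsupp.single_apply, if_neg, smul_zero]
      rintro rfl
      simp at hu'
    · intro u hu hu'
      rw [Finsupp.single_apply, if_neg, mul_zero]
      rintro rfl
      simp at hu'
    · intro u hu hu'
      rw [mem_compl] at hu'
      by_cases h : σ = insert u ρ
      · subst h
        rw [erase_insert hu', Finsupp.single_eq_same, Finsupp.single_eq_same,
          filter_insert, if_neg (lt_irrefl u), smul_eq_mul, mul_comm]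
      · rw [Finsupp.single_apply, Finsupp.single_apply, if_neg h, if_neg, smul_zero, mul_zero]
        rintro rfl
        exact h (insert_erase hu).symm

theorem boundaryMap_boundaryMap [Fintype V] (z : Finset V →₀ F) :
    boundaryMap F (boundaryMap F z) = 0 := by
  ext ρ
  rw [boundaryMap_apply]
  simp_rw [boundaryMap_apply, mul_sum, Finsupp.zero_apply]
  rw [sum_sigma']
  -- Adding two vertices in either order reaches the same simplex, with opposite signs.
  refine sum_involution (fun x _ => ⟨x.2, x.1⟩) ?_ ?_ ?_ ?_
  · rintro ⟨u, w⟩ h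
    simp only [mem_sigma, mem_compl, mem_insert, not_or] at h
    obtain ⟨hu, hwu, hw⟩ := h
    dsimp only
    rw [Finset.insert_comm w u ρ, filter_insert, filter_insert]
    rcases lt_or_gt_of_ne hwu with hlt | hlt
    · rw [if_neg hlt.not_gt, if_pos hlt, card_insert_of_notMem (by simp [hw])]
      ring
    · rw [if_pos hlt, if_neg hlt.not_gt, card_insert_of_notMem (by simp [hu])]
      ring
  · rintro ⟨u, w⟩ h _ heq
    simp only [mem_sigma, mem_compl, mem_insert, not_or] at h
    simp only [Sigma.mk.injEq, heq_eq_eq] at heq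
    exact h.2.1 heq.1
  · rintro ⟨u, w⟩ h
    simp only [mem_sigma, mem_compl, mem_insert, not_or] at h ⊢
    exact ⟨h.2.2, Ne.symm h.2.1, h.1⟩
  · rintro ⟨u, w⟩ h
    rfl

end LeadingFaces

/-! ### Critical faces form an antichain bounding the total Betti number. -/

section CriticalFaces

variable {V : Type*} {F : Type*} [Field F]

theorem mem_reducedChains {K : PreAbstractSimplicialComplex V} {i : ℤ} {z : Finset V →₀ F} :
    z ∈ reducedChains F K i ↔ ∀ σ, z σ ≠ 0 → (σ ∈ K.faces ∨ σ = ∅) ∧ (#σ : ℤ) = i + 1 := by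
  rw [reducedChains, Finsupp.mem_supported]
  simp [Set.subset_def]

theorem single_mem_reducedChains {K : PreAbstractSimplicialComplex V} {i : ℤ} {σ : Finset V}
    (hσ : σ ∈ K.faces) (hi : (#σ : ℤ) = i + 1) (c : F) :
    Finsupp.single σ c ∈ reducedChains F K i :=
  Finsupp.single_mem_supported F c ⟨Or.inl hσ, hi⟩

variable [LinearOrder V]

theorem boundaryMap_mem_reducedChains [Fintype V] {K : PreAbstractSimplicialComplex V} {i : ℤ}
    {z : Finset V →₀ F} (hz : z ∈ reducedChains F K (i + 1)) :
    boundaryMap F z ∈ reducedChains F K i := by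
  rw [mem_reducedChains] at hz ⊢
  intro σ hσ
  rw [boundaryMap_apply] at hσ
  obtain ⟨u, hu, h⟩ := exists_ne_zero_of_sum_ne_zero hσ
  obtain ⟨h1, h2⟩ := hz _ (right_ne_zero_of_mul h)
  rw [mem_compl] at hu
  rw [card_insert_of_notMem hu] at h2
  refine ⟨?_, by push_cast at h2; omega⟩
  rcases σ.eq_empty_or_nonempty with h0 | h0
  · exact Or.inr h0
  · exact Or.inl ((K.isRelLowerSet_faces (h1.resolve_right (insert_ne_empty _ _))).2
      (subset_insert _ _) h0)

theorem reducedBoundaries_le_reducedCycles [Fintype V] (K : PreAbstractSimplicialComplex V)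
    (i : ℤ) : reducedBoundaries F K i ≤ reducedCycles F K i := by
  rintro _ ⟨z, hz, rfl⟩
  exact ⟨boundaryMap_mem_reducedChains hz, boundaryMap_boundaryMap z⟩

theorem reducedCycles_le_top (K : PreAbstractSimplicialComplex V) (i : ℤ) :
    reducedCycles F K i ≤ reducedCycles F ⊤ i := by
  refine inf_le_inf_right _ fun z hz => ?_
  rw [mem_reducedChains] at hz ⊢
  intro σ hσ
  exact ⟨(hz σ hσ).1.imp_left fun h => (K.isRelLowerSet_faces h).1, (hz σ hσ).2⟩

/-- A cycle is determined by its coefficients at the sets avoiding a given vertex. -/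
theorem determinedAwayFrom_reducedCycles [Fintype V] (v : V) (K : PreAbstractSimplicialComplex V)
    (i : ℤ) : DeterminedAwayFrom v (reducedCycles F K i) := by
  intro z hz h
  have hz0 : boundaryMap F z = 0 := hz.2
  ext σ
  by_cases hv : v ∈ σ
  · have h1 : boundaryMap F z (σ.erase v) = 0 := by rw [hz0, Finsupp.zero_apply]
    rw [boundaryMap_apply, sum_eq_single v, insert_erase hv] at h1
    · simpa using h1
    · intro u hu huv
      rw [h _ (by simp [huv.symm]), mul_zero]
    · simp
  · exact h σ hv

theorem card_of_mem_leadingFaces {v : V} {K : PreAbstractSimplicialComplex V} {i : ℤ}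
    {S : Finset V} (hS : S ∈ leadingFaces v (reducedCycles F K i)) : (#S : ℤ) = i + 1 := by
  obtain ⟨z, hz, hzS⟩ := hS
  exact (mem_reducedChains.1 hz.1 S hzS.2.1).2

/-- Removing a vertex from a leading face of a cycle yields a leading face of a boundary, namely
of the boundary of the part of the cycle in the star of that vertex. -/
theorem erase_mem_leadingFaces_reducedBoundaries [Fintype V] {v : V}
    {K : PreAbstractSimplicialComplex V} {i : ℤ} {S : Finset V}
    (hS : S ∈ leadingFaces v (reducedCycles F K (i + 1))) {a : V} (ha : a ∈ S) :
    S.erase a ∈ leadingFaces v (reducedBoundaries F K i) := by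
  obtain ⟨z, hz, hvS, hzS, hmax⟩ := hS
  have hz0 : boundaryMap F z = 0 := hz.2
  set w := boundaryMap F (z.filter (a ∈ ·)) with hw
  -- Every extension of `T` contains `a`, so here `w` agrees with the boundary of `z`, which is
  -- zero.
  have hmem : ∀ T, a ∈ T → w T = 0 := by
    intro T haT
    rw [hw, boundaryMap_apply, ← Finsupp.zero_apply (a := T), ← hz0, boundaryMap_apply]
    exact sum_congr rfl fun u _ => by rw [Finsupp.filter_apply, if_pos (mem_insert_of_mem haT)]
  have hnotMem : ∀ T, a ∉ T → w T = (-1) ^ #(T.filter (· < a)) * z (insert a T) := by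
    intro T haT
    rw [hw, boundaryMap_apply, sum_eq_single a]
    · rw [Finsupp.filter_apply, if_pos (mem_insert_self _ _)]
    · intro u _ hua
      rw [Finsupp.filter_apply, if_neg (by simp [haT, hua.symm]), mul_zero]
    · simp [haT]
  have hva : v ≠ a := fun h => hvS (h ▸ ha)
  refine ⟨w, ⟨z.filter (a ∈ ·), ?_, rfl⟩, fun h => hvS (mem_of_mem_erase h), ?_, fun T hT hlt => ?_⟩
  · have hzK := mem_reducedChains.1 hz.1
    refine mem_reducedChains.2 fun σ hσ => hzK σ fun h0 => hσ ?_
    rw [Finsupp.filter_apply, h0, ite_self]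
  · rw [hnotMem _ (notMem_erase a S), insert_erase ha]
    exact mul_ne_zero (pow_ne_zero _ (by simp)) hzS
  · by_cases haT : a ∈ T
    · exact hmem T haT
    · rw [hnotMem T haT, hmax, mul_zero]
      · simp [hva, hT]
      -- Removing the common element `a` does not change the colex comparison of `S` with `insert a
      -- T`.
      · have h1 := Finset.Colex.toColex_sdiff_lt_toColex_sdiff (s := S) (t := insert a T)
          (u := {a}) (by simpa) (by simp)
        rw [sdiff_singleton_eq_erase, sdiff_singleton_eq_erase, erase_insert haT] at h1
        exact h1.1 hlt

/-- Boundaries are cycles, so vertices can be removed one after another. -/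
theorem mem_leadingFaces_reducedBoundaries_of_ssubset [Fintype V] {v : V}
    {K : PreAbstractSimplicialComplex V} {S T : Finset V}
    (hS : S ∈ leadingFaces v (reducedCycles F K (#S - 1))) (hTS : T ⊂ S) :
    T ∈ leadingFaces v (reducedBoundaries F K (#T - 1)) := by
  induction S using Finset.strongInduction with
  | H S ih =>
    obtain ⟨a, haS, haT⟩ := exists_of_ssubset hTS
    have hcard : #S = #(S.erase a) + 1 := (card_erase_add_one haS).symm
    have h1 : S.erase a ∈ leadingFaces v (reducedBoundaries F K (#(S.erase a) - 1)) := by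
      refine erase_mem_leadingFaces_reducedBoundaries ?_ haS
      rw [hcard] at hS
      convert hS using 3
      push_cast
      ring
    rcases (subset_erase.2 ⟨hTS.1, haT⟩).eq_or_ssubset with h | h
    · rwa [h]
    · exact ih _ (erase_ssubset haS)
        (leadingFaces_mono v (reducedBoundaries_le_reducedCycles K _) h1) h

variable (F) in
/-- The leading faces of cycles which are not leading faces of boundaries. -/
def criticalFaces (v : V) (K : PreAbstractSimplicialComplex V) : Set (Finset V) :=
  {S | S ∈ leadingFaces v (reducedCycles F K (#S - 1)) ∧
    S ∉ leadingFaces v (reducedBoundaries F K (#S - 1))}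

open Classical in
variable (F) in
/-- The critical faces as sets of vertices other than the distinguished one. -/
noncomputable def criticalFamily [Fintype V] (v : V) (K : PreAbstractSimplicialComplex V) :
    Finset (Finset {w // w ≠ v}) :=
  univ.filter fun s => s.map (Function.Embedding.subtype _) ∈ criticalFaces F v K

theorem mem_criticalFamily [Fintype V] {v : V} {K : PreAbstractSimplicialComplex V}
    {s : Finset {w // w ≠ v}} : s ∈ criticalFamily F v K ↔
      s.map (Function.Embedding.subtype _) ∈ criticalFaces F v K := by
  simp [criticalFamily]

theorem isAntichain_criticalFamily [Fintype V] (v : V) (K : PreAbstractSimplicialComplex V) :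
    IsAntichain (· ⊆ ·) (criticalFamily F v K : Set (Finset {w // w ≠ v})) := by
  intro s hs t ht hne hst
  exact (mem_criticalFamily.1 hs).2 (mem_leadingFaces_reducedBoundaries_of_ssubset
    (mem_criticalFamily.1 ht).1 (map_ssubset_map.2 (hst.ssubset_of_ne hne)))

theorem reducedBetti_le [Fintype V] (v : V) (K : PreAbstractSimplicialComplex V) (i : ℤ) :
    reducedBetti F K i ≤ #((criticalFamily F v K).filter fun s => (#s : ℤ) - 1 = i) := by
  classical
  rw [← card_map (mapEmbedding (Function.Embedding.subtype (· ≠ v))).toEmbedding]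
  refine (determinedAwayFrom_reducedCycles v K i).finrank_subquotient_le
    (reducedBoundaries_le_reducedCycles K i) ?_
  intro S hS
  have hcard := card_of_mem_leadingFaces hS.1
  have hi : (#S : ℤ) - 1 = i := by omega
  have hv : ∀ w ∈ S, w ≠ v := by
    rintro w hw rfl
    obtain ⟨z, -, hz⟩ := hS.1
    exact hz.1 hw
  have hmap : (S.subtype (· ≠ v)).map (Function.Embedding.subtype _) = S :=
    subtype_map_of_mem hv
  refine mem_coe.2 (mem_map.2 ⟨S.subtype (· ≠ v), mem_filter.2 ⟨mem_criticalFamily.2 ?_, ?_⟩, hmap⟩)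
  · rw [hmap]
    exact ⟨by rw [hi]; exact hS.1, by rw [hi]; exact hS.2⟩
  · rw [← card_map (Function.Embedding.subtype _), hmap, hi]

theorem reducedTotalBetti_le_card_criticalFamily [Fintype V] (v : V)
    (K : PreAbstractSimplicialComplex V) :
    reducedTotalBetti F K ≤ #(criticalFamily F v K) := by
  have hmaps : Set.MapsTo (fun s : Finset {w // w ≠ v} => (#s : ℤ) - 1) (criticalFamily F v K)
      (Finset.Icc (-1 : ℤ) ((Fintype.card V : ℤ) - 1)) := by
    intro s _
    have : #s ≤ Fintype.card V :=
      (card_map (Function.Embedding.subtype (· ≠ v))).symm.trans_le (card_le_univ _)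
    simp only [coe_Icc, Set.mem_Icc]
    omega
  rw [reducedTotalBetti, card_eq_sum_card_fiberwise hmaps]
  exact sum_le_sum fun i _ => reducedBetti_le v K i

theorem card_subtype_ne [Fintype V] (v : V) :
    Fintype.card {w // w ≠ v} = Fintype.card V - 1 := by
  rw [Fintype.card_subtype_compl, Fintype.card_subtype_eq]

theorem reducedTotalBetti_le_choose [Fintype V] [Nonempty V]
    (K : PreAbstractSimplicialComplex V) :
    reducedTotalBetti F K ≤ (Fintype.card V - 1).choose ((Fintype.card V - 1) / 2) := by
  obtain ⟨v⟩ := ‹Nonempty V›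
  refine (reducedTotalBetti_le_card_criticalFamily v K).trans ?_
  rw [← card_subtype_ne v]
  exact (isAntichain_criticalFamily v K).sperner

end CriticalFaces

/-! ### Skeleta and the equality case. -/

section EqualityCase

variable {V : Type*} [LinearOrder V] [Fintype V] {F : Type*} [Field F]

/-- Away from `v`, the boundary of the cone over `S` is just `S` up to sign; this makes the cone
boundaries independent. -/
theorem boundaryMap_single_insert_apply {v : V} {S T : Finset V} (hS : v ∉ S) (hT : v ∉ T) :
    boundaryMap F (Finsupp.single (insert v S) 1) T =
      if T = S then (-1) ^ #(T.filter (· < v)) else 0 := by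
  rw [boundaryMap_apply, sum_eq_single v]
  · by_cases h : T = S
    · rw [h, Finsupp.single_eq_same, if_pos rfl, mul_one]
    · rw [if_neg h, Finsupp.single_eq_of_ne, mul_zero]
      exact fun h' => h (by rw [← erase_insert hT, h', erase_insert hS])
  · intro u hu huv
    rw [Finsupp.single_eq_of_ne, mul_zero]
    intro h
    have : v ∈ insert u T := h ▸ mem_insert_self v S
    exact (mem_insert.1 this).elim (fun h => huv h.symm) hT
  · simp [hT]

variable {K : PreAbstractSimplicialComplex V} {r : ℕ}

variable (F) in
/-- If `K` consists of all sets with at most `r` elements, then its Betti number in dimension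
`r - 1` is at least the dimension of the space of all cycles of that dimension. -/
theorem choose_le_reducedBetti [Nonempty V]
    (hK : ∀ s : Finset V, s.Nonempty → (s ∈ K.faces ↔ #s ≤ r)) :
    (Fintype.card V - 1).choose r ≤ reducedBetti F K (r - 1) := by
  classical
  obtain ⟨v⟩ := ‹Nonempty V›
  have hchains : reducedChains F K ((r : ℤ) - 1 + 1) = ⊥ := by
    rw [eq_bot_iff]
    intro z hz
    rw [Submodule.mem_bot]
    ext σ
    by_contra hσ
    obtain ⟨h1, h2⟩ := mem_reducedChains.1 hz σ hσ
    have hne : σ.Nonempty := card_pos.1 (by omega)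
    have := (hK σ hne).1 (h1.resolve_right hne.ne_empty)
    omega
  have hB : reducedBoundaries F K ((r : ℤ) - 1) = ⊥ := by
    rw [reducedBoundaries, hchains, Submodule.map_bot]
  let b : powersetCard r (univ.erase v) → (Finset V →₀ F) := fun S =>
    boundaryMap F (Finsupp.single (insert v S.1) 1)
  have hmem : ∀ S : powersetCard r (univ.erase v), v ∉ S.1 ∧ #S.1 = r := fun S =>
    ⟨fun h => notMem_erase v univ ((mem_powersetCard.1 S.2).1 h), (mem_powersetCard.1 S.2).2⟩
  have hb : ∀ S, b S ∈ reducedCycles F K (r - 1) := by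
    intro S
    refine ⟨?_, boundaryMap_boundaryMap _⟩
    -- The cone itself is not a face of `K`, so its boundary is first taken in the full simplex; its
    -- simplices have `r` vertices and hence lie in `K`.
    have h1 : b S ∈ reducedChains F ⊤ ((r : ℤ) - 1) := by
      refine boundaryMap_mem_reducedChains (single_mem_reducedChains ?_ ?_ 1)
      · exact insert_nonempty _ _
      · rw [card_insert_of_notMem (hmem S).1, (hmem S).2]
        push_cast
        ring
    rw [SetLike.mem_coe, mem_reducedChains] at *
    intro σ hσ
    obtain ⟨-, h3⟩ := h1 σ hσ
    refine ⟨?_, h3⟩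
    rcases σ.eq_empty_or_nonempty with h0 | h0
    · exact Or.inr h0
    · exact Or.inl ((hK σ h0).2 (by omega))
  -- In the coordinates at the `r`-sets avoiding `v`, the family `b` is diagonal with entries `±1`.
  let φ : (Finset V →₀ F) →ₗ[F] (powersetCard r (univ.erase v) → F) :=
    LinearMap.pi fun S => Finsupp.lapply S.1
  have hφ : φ ∘ b = fun S => Pi.single S ((-1) ^ #(S.1.filter (· < v))) := by
    ext S T
    simp only [Function.comp_apply, φ, b, LinearMap.pi_apply, Finsupp.lapply_apply]
    rw [boundaryMap_single_insert_apply (hmem S).1 (hmem T).1, Pi.single_apply]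
    by_cases h : T = S
    · simp [h]
    · rw [if_neg h, if_neg fun h' => h (Subtype.ext h')]
  have hli : LinearIndependent F b := by
    refine LinearIndependent.of_comp φ ?_
    rw [hφ]
    exact Pi.linearIndependent_single_of_ne_zero fun S => pow_ne_zero _ (by simp)
  have hspan := Submodule.finrank_mono (Submodule.span_le.2 (Set.range_subset_iff.2 hb))
  rw [finrank_span_eq_card hli, Fintype.card_coe, card_powersetCard,
    card_erase_of_mem (mem_univ v), card_univ] at hspan
  refine hspan.trans_eq ?_
  have hfin := finrank_subquotient_bot F (reducedCycles F K ((r : ℤ) - 1))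
  rw [← hB] at hfin
  exact hfin.symm

variable (F) in
theorem choose_le_reducedTotalBetti [Nonempty V]
    (hK : ∀ s : Finset V, s.Nonempty → (s ∈ K.faces ↔ #s ≤ r)) (hr : r ≤ Fintype.card V) :
    (Fintype.card V - 1).choose r ≤ reducedTotalBetti F K :=
  (choose_le_reducedBetti F hK).trans
    (single_le_sum (f := fun i => reducedBetti F K i) (fun _ _ => Nat.zero_le _)
      (mem_Icc.2 ⟨by omega, by omega⟩))

theorem mem_faces_iff_of_criticalFaces {v : V} (hr : r < Fintype.card V)
    (h : ∀ S : Finset V, v ∉ S → #S = r → S ∈ criticalFaces F v K) (s : Finset V)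
    (hs : s.Nonempty) : s ∈ K.faces ↔ #s ≤ r := by
  have hdet : ∀ L : PreAbstractSimplicialComplex V,
      DeterminedAwayFrom v (reducedCycles F L ((r : ℤ) - 1)) :=
    fun L => determinedAwayFrom_reducedCycles v L _
  have hlead : leadingFaces v (reducedCycles F ⊤ ((r : ℤ) - 1)) ⊆
      leadingFaces v (reducedCycles F K ((r : ℤ) - 1)) := by
    intro S hS
    have hcard : #S = r := by
      have := card_of_mem_leadingFaces hS
      omega
    obtain ⟨z, -, hz⟩ := hS
    have := (h S hz.1 hcard).1
    rwa [hcard] at this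
  -- All possible leading faces already occur in `K`, so every cycle of the full simplex in this
  -- dimension lives on `K`.
  have htop := (hdet ⊤).le_of_leadingFaces_subset (reducedCycles_le_top K _) hlead
  have hsingle : ∀ σ : Finset V, ∀ a ∈ σ,
      boundaryMap F (Finsupp.single σ 1) (σ.erase a) ≠ 0 := by
    intro σ a ha
    rw [← insert_erase ha, erase_insert (notMem_erase a σ),
      boundaryMap_single_insert_apply (notMem_erase a σ) (notMem_erase a σ), if_pos rfl]
    exact pow_ne_zero _ (by simp)
  constructor
  · intro hsK
    by_contra! hlt
    obtain ⟨σ, hσs, hσ⟩ := exists_subset_card_eq (Nat.succ_le_of_lt hlt)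
    have hσne : σ.Nonempty := card_pos.1 (by omega)
    have hσK : σ ∈ K.faces := (K.isRelLowerSet_faces hsK).2 hσs hσne
    obtain ⟨a, ha⟩ := hσne
    -- A face with `r + 1` vertices has a nonzero boundary, whose leading face would then not be
    -- critical.
    have hmem : boundaryMap F (Finsupp.single σ 1) ∈ reducedBoundaries F K ((r : ℤ) - 1) :=
      ⟨_, single_mem_reducedChains hσK (by rw [hσ]; push_cast; ring) 1, rfl⟩
    have hmem' := reducedBoundaries_le_reducedCycles K _ hmem
    obtain ⟨S, hS⟩ := (hdet K).exists_isLeadingFace hmem' fun h0 => hsingle σ a ha (by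
      rw [h0, Finsupp.zero_apply])
    have hcard : #S = r := by
      have := card_of_mem_leadingFaces ⟨_, hmem', hS⟩
      omega
    refine (h S hS.1 hcard).2 ?_
    rw [hcard]
    exact ⟨_, hmem, hS⟩
  · intro hle
    obtain ⟨t, hst, -, ht⟩ := exists_subsuperset_card_eq (subset_univ s) hle
      (by rw [card_univ]; exact hr.le)
    have htne : t.Nonempty := hs.mono hst
    -- Since `r < Fintype.card V`, `t` lies in a larger simplex, whose boundary is a cycle with `t`
    -- in its support.
    obtain ⟨a, ha⟩ : ∃ a, a ∉ t := by
      by_contra! hall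
      rw [eq_univ_of_forall hall, card_univ] at ht
      omega
    have hcard : #(insert a t) = r + 1 := by rw [card_insert_of_notMem ha, ht]
    have hmem : boundaryMap F (Finsupp.single (insert a t) 1) ∈
        reducedCycles F ⊤ ((r : ℤ) - 1) :=
      reducedBoundaries_le_reducedCycles _ _ ⟨_, single_mem_reducedChains
        (insert_nonempty _ _) (by rw [hcard]; push_cast; ring) 1, rfl⟩
    have hne := hsingle (insert a t) a (mem_insert_self _ _)
    rw [erase_insert ha] at hne
    have htK := ((mem_reducedChains.1 (htop hmem).1 t hne).1).resolve_right htne.ne_empty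
    exact (K.isRelLowerSet_faces htK).2 hst hs

theorem exists_mem_faces_iff_of_reducedTotalBetti_eq [Nonempty V]
    (h : reducedTotalBetti F K = (Fintype.card V - 1).choose ((Fintype.card V - 1) / 2)) :
    ∃ r, (r = (Fintype.card V - 1) / 2 ∨
        r = (Fintype.card V - 1) - (Fintype.card V - 1) / 2) ∧
      ∀ s : Finset V, s.Nonempty → (s ∈ K.faces ↔ #s ≤ r) := by
  have v : V := Classical.arbitrary V
  have hpos : 0 < Fintype.card V := Fintype.card_pos
  have hanti := isAntichain_criticalFamily (F := F) v K
  obtain ⟨r, hr, hA⟩ := eq_powersetCard_of_isAntichain_of_card_eq hanti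
    (le_antisymm hanti.sperner (by
      rw [card_subtype_ne, ← h]
      exact reducedTotalBetti_le_card_criticalFamily v K))
  rw [card_subtype_ne] at hr
  refine ⟨r, hr, mem_faces_iff_of_criticalFaces (F := F) (v := v) (by omega) fun S hv hS => ?_⟩
  have hmap : (S.subtype (· ≠ v)).map (Function.Embedding.subtype _) = S :=
    subtype_map_of_mem fun w hw hwv => hv (hwv ▸ hw)
  have hmem : S.subtype (· ≠ v) ∈ criticalFamily F v K := by
    rw [hA, mem_powersetCard_univ, ← card_map (Function.Embedding.subtype _), hmap, hS]
  rw [mem_criticalFamily, hmap] at hmem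
  exact hmem

end EqualityCase

/-! ### From face sizes to isomorphism with a skeleton. -/

theorem mem_faces_skeleton_top {W : Type*} {k : ℤ} {s : Finset W} :
    s ∈ ((⊤ : PreAbstractSimplicialComplex W).skeleton k).faces ↔
      s.Nonempty ∧ (#s : ℤ) ≤ k + 1 := Iff.rfl

/-- A complex on `m` vertices is isomorphic to a skeleton of the simplex on `m` vertices if and
only if its faces are all sets of vertices of at most the corresponding size. -/
theorem isomorphic_skeleton_top_iff {V : Type*} [Fintype V] [Nonempty V]
    {K : PreAbstractSimplicialComplex V} (hK : ∀ v, {v} ∈ K.faces) {m : ℕ}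
    (hm : Fintype.card V = m) {k : ℤ} :
    Isomorphic K ((⊤ : PreAbstractSimplicialComplex (Fin m)).skeleton k) ↔
      ∀ s : Finset V, s.Nonempty → (s ∈ K.faces ↔ (#s : ℤ) ≤ k + 1) := by
  classical
  constructor
  · rintro ⟨e, he⟩ s hs
    have hmap : (s.subtype (· ∈ K.vertices)).map (Function.Embedding.subtype _) = s :=
      subtype_map_of_mem fun w _ => hK w
    have hne : (s.subtype (· ∈ K.vertices)).Nonempty := by
      rw [← map_nonempty (f := Function.Embedding.subtype _), hmap]
      exact hs
    have h1 := he (s.subtype (· ∈ K.vertices))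
    rw [hmap, mem_faces_skeleton_top, card_map, card_map,
      ← card_map (Function.Embedding.subtype _), hmap] at h1
    rw [h1, and_iff_right]
    simpa using hne
  · intro h
    -- Singletons are faces of `K`, which excludes `k = -1`; thus all of `Fin m` are vertices of the
    -- skeleton.
    have hk : 1 ≤ k + 1 := by
      obtain ⟨v⟩ := ‹Nonempty V›
      simpa using (h {v} (singleton_nonempty v)).1 (hK v)
    have hL : ∀ v, v ∈ ((⊤ : PreAbstractSimplicialComplex (Fin m)).skeleton k).vertices :=
      fun v => mem_faces_skeleton_top.2 ⟨singleton_nonempty v, by simpa using hk⟩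
    refine ⟨(Equiv.subtypeUnivEquiv hK).trans
      ((Fintype.equivFinOfCardEq hm).trans (Equiv.subtypeUnivEquiv hL).symm), fun s => ?_⟩
    rw [mem_faces_skeleton_top, card_map, card_map, map_nonempty, map_nonempty]
    rcases s.eq_empty_or_nonempty with rfl | hs
    · simp only [map_empty, Finset.not_nonempty_empty, false_and, iff_false]
      exact fun h0 => Finset.not_nonempty_empty (K.isRelLowerSet_faces h0).1
    · rw [h _ (hs.map), card_map, and_iff_right hs]

end PreAbstractSimplicialComplex

open PreAbstractSimplicialComplex in
theorem theorem2p2 {V : Type*} [LinearOrder V] [Fintype V] (F : Type*) [Field F]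
    (K : AbstractSimplicialComplex V) (m : ℕ) (hV : Fintype.card V = m) (hm : 1 ≤ m) :
    reducedTotalBetti F K.toPreAbstractSimplicialComplex ≤ (m - 1).choose ((m - 1) / 2) ∧
    (reducedTotalBetti F K.toPreAbstractSimplicialComplex = (m - 1).choose ((m - 1) / 2) ↔
      (Odd m ∧ Isomorphic K.toPreAbstractSimplicialComplex
        ((⊤ : PreAbstractSimplicialComplex (Fin m)).skeleton (((m : ℤ) - 3) / 2))) ∨
      (Even m ∧
        (Isomorphic K.toPreAbstractSimplicialComplex
            ((⊤ : PreAbstractSimplicialComplex (Fin m)).skeleton ((m : ℤ) / 2 - 1)) ∨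
          Isomorphic K.toPreAbstractSimplicialComplex
            ((⊤ : PreAbstractSimplicialComplex (Fin m)).skeleton ((m : ℤ) / 2 - 2))))) := by
  have : Nonempty V := Fintype.card_pos_iff.1 (by omega)
  have hle := reducedTotalBetti_le_choose (F := F) K.toPreAbstractSimplicialComplex
  rw [hV] at hle
  refine ⟨hle, ?_⟩
  have hiso {k : ℤ} := isomorphic_skeleton_top_iff K.singleton_mem hV (k := k)
  have hiff : reducedTotalBetti F K.toPreAbstractSimplicialComplex =
      (m - 1).choose ((m - 1) / 2) ↔
      ∃ r, (r = (m - 1) / 2 ∨ r = (m - 1) - (m - 1) / 2) ∧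
        ∀ s : Finset V, s.Nonempty → (s ∈ K.faces ↔ s.card ≤ r) := by
    constructor
    · intro h
      have := exists_mem_faces_iff_of_reducedTotalBetti_eq (F := F)
        (K := K.toPreAbstractSimplicialComplex) (by rw [hV]; exact h)
      rwa [hV] at this
    · rintro ⟨r, hr, h⟩
      refine le_antisymm hle ?_
      have h1 := choose_le_reducedTotalBetti F h (by omega)
      rw [hV] at h1
      refine le_trans (le_of_eq ?_) h1
      rcases hr with rfl | rfl
      · rfl
      · exact (Nat.choose_symm (Nat.div_le_self _ 2)).symm
  -- Faces with at most `r` vertices are those of dimension at most `k = r - 1`.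
  have hcast : ∀ (r : ℕ) (k : ℤ), (r : ℤ) = k + 1 →
      ((∀ s : Finset V, s.Nonempty → (s ∈ K.faces ↔ s.card ≤ r)) ↔
        Isomorphic K.toPreAbstractSimplicialComplex
          ((⊤ : PreAbstractSimplicialComplex (Fin m)).skeleton k)) := by
    intro r k hrk
    rw [hiso, ← hrk]
    simp only [Nat.cast_le]
  rw [hiff]
  rcases Nat.even_or_odd m with heven | hodd
  · obtain ⟨n, rfl⟩ := id heven
    rw [← hcast (n + n - 1 - (n + n - 1) / 2) (((n + n : ℕ) : ℤ) / 2 - 1) (by omega),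
      ← hcast ((n + n - 1) / 2) (((n + n : ℕ) : ℤ) / 2 - 2) (by omega)]
    have hnot : ¬ Odd (n + n) := Nat.not_odd_iff_even.2 heven
    simp only [hnot, heven, false_and, true_and, false_or, or_and_right, exists_or,
      exists_eq_left]
    exact or_comm
  · obtain ⟨n, rfl⟩ := id hodd
    rw [← hcast ((2 * n + 1 - 1) / 2) ((((2 * n + 1 : ℕ) : ℤ) - 3) / 2) (by omega)]
    have hnot : ¬ Even (2 * n + 1) := Nat.not_even_iff_odd.2 hodd
    have hmid : 2 * n + 1 - 1 - (2 * n + 1 - 1) / 2 = (2 * n + 1 - 1) / 2 := by omega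
    simp only [hnot, hodd, hmid, false_and, true_and, or_false, or_self, exists_eq_left]
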